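/- **Setting.** Let $I$ and $O$ be finite disjoint sets of input and output signals, $\Sigma_I=2^I$, $\Sigma_O=2^O$, $\Sigma=2^{I\cup O}$. Let $A$ be a (deterministic, complete, finite-state) parity automaton over $\Sigma$ with states $Q_A$, initial state $a_0$, transition function $\Delta_A$, and priority function $p:Q_A\to\mathbb N$. Its language $L_A$ is the set of words on whose run the least priority of the states visited infinitely often is even. $A$ is a *safety automaton* if all its priorities are $0$ or $1$ and no transition leads from a priority-$1$ state to a priority-$0$ state. Let $B$ be a (deterministic, complete, finite-state) mean-payoff automaton over $\Sigma$ with states $Q_B$, initial state $b_0$, transition function $\Delta_B$ and rewards $r:Q_B\times\Sigma\to\mathbb N$, and let $L_B(w)=\liminf_n\frac1n\sum_{i<n}r(\rho_i,w_i)$, where $\rho$ is the run of $B$ on $w$. Let $(G,\lambda)$ be a finite Markov chain with states $S$, initial state $s_0$ and transition function $\delta$, labeled by $\lambda:S\to\Sigma_I$, that is deterministic and complete: every state has exactly one successor (of positive probability) with each label. Let $\mu$ be the law on $\Sigma_I^\omega$ of $\lambda(s_1)\lambda(s_2)\lambda(s_3)\dots$ for the random walk $s_0s_1s_2\dots$ of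 $G$. A *state machine* $M$ has a (finite or infinite) set of states, an initial state, a transition function reading letters of $\Sigma_I$, and an output in $\Sigma_O$ on every transition; $\mathcal O_M(w)\in\Sigma^\omega$ is the word whose $k$-th letter is the union of $w_k$ and the $k$-th output of $M$ on $w$. $M$ *satisfies $L_A$ under $\mu$* if $\mathbb E_\mu[\mathbf 1_{L_A}\circ\mathcal O_M]=1$. Its value $V(M)$ is $\mathbb E_\mu[L_B\circ\mathcal O_M]$ if $M$ satisfies $L_A$ under $\mu$, and $\bot$ (smaller than every real) otherwise. $M$ *optimizes $L_B$ under $\mu$ subject to $L_A$* if $V(M)\ge V(M')$ for all state machines $M'$, finite or infinite. In an MDP, the expectation $\mathbb E^\pi_s[f]$ of an objective $f$ with values in $\mathbb R\cup\{\bot\}$ is $\bot$ if $f=\bot$ with positive probability, and the usual expectation otherwise; a strategy $\pi$ is *optimal* from $s$ for $f$ if $\mathbb E^\pi_s[f]$ equals the supremum of $\mathbb E_s^{\pi'}[f]$ over all (history-dependent, randomized) strategies $\pi'$. For a reward function $\rho$ with values in $\mathbb N\cup\{\bot\}$, $\mathrm{Mean}[\rho](\omega)$ is the $\liminf$ of the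 average rewards along the play $\omega$, and $\bot$ if a reward $\bot$ occurs on $\omega$. $\mathrm{MP}[q,\rho](\omega)$ is $\mathrm{Mean}[\rho](\omega)$ if the least priority (under $q$) of the states visited infinitely often is even, and $\bot$ otherwise. **Construction.** Let $G'$ be the following MDP. Its probabilistic states are $(a,b,s,\ell)$ with $a\in Q_A$, $b\in Q_B$, $s\in S$ and $\ell\in\{-\}\cup(Q_B\times\Sigma_O)$; its player-1 states are $(a,b,s)$; its initial state is $s_0'=(a_0,b_0,s_0,-)$. From $(a,b,s,\ell)$ it moves to $(a,b,s')$ with probability $\delta(s)(s')$. In $(a,b,s)$ the player chooses $\tau\in\Sigma_O$ and moves to $(\Delta_A(a,\sigma),\Delta_B(b,\sigma),s,(b,\tau))$, where $\sigma=\lambda(s)\cup\tau$. The label of $(a,b,s)$ is the input letter $\lambda(s)$, that of $(a,b,s,(b',\tau))$ is the output letter $\tau$, and that of $(a,b,s,-)$ is the output letter $\emptyset$. The priority function $p'$ gives $p(a)$ to every state with first component $a$. The reward function $r'$ gives $r(b',\lambda(s)\cup\tau)$ to $(a,b,s,(b',\tau))$ and $0$ to all other states. The reward function $r'_{\bot}$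 is $r'$ with the rewards of all states of priority $1$ replaced by $\bot$. **Claim.** In $G'$, distinct successors of the same state have distinct labels; the labels of the successors of a probabilistic state are exactly all input letters, and those of a player-1 state exactly all output letters. Let $f=\mathrm{MP}[p',r']$; or, if $A$ is a safety automaton, let $f$ be either $\mathrm{MP}[p',r']$ or $\mathrm{Mean}[r'_\bot]$. Then for every pure strategy $\pi$ of $G'$ that is optimal from $s'_0$ for $f$ and for which $\mathbb E^{\pi}_{s_0'}[f]\neq\bot$ there is a state machine $M$ such that 1. $M$ corresponds to $\pi$: for every $w\in\Sigma_I^\omega$ there is a play from $s_0'$ consistent with $\pi$ whose input labels (those at positions $1,3,5,\dots$) form $w$, and on every such play the output labels (those at positions $2,4,6,\dots$) are the outputs of $M$ on $w$; 2. $M$ satisfies $L_A$ under $\mu$; 3. $M$ optimizes $L_B$ under $\mu$ subject to $L_A$. If $\pi$ is a pure finite-state strategy (in particular, if it is pure memoryless), $M$ can be chosen with finitely many states. -/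

import Mathlib

open MeasureTheory ProbabilityTheory Filter

namespace QSynth

noncomputable section

/-! ### Words, automata and their languages -/

/-- A deterministic complete automaton over the alphabet `Γ` with state set `Q`. -/
structure Automaton (Γ Q : Type*) where
  init : Q
  next : Q → Γ → Q

/-- The run `ρ₀ρ₁…` of an automaton on an infinite word `w₀w₁…`. -/
def Automaton.run {Γ Q : Type*} (A : Automaton Γ Q) (w : ℕ → Γ) : ℕ → Q
  | 0 => A.init
  | n + 1 => A.next (A.run w n) (w n)

/-- The set of elements that occur infinitely often in a sequence. -/
def infOcc {Q : Type*} (ρ : ℕ → Q) : Set Q :=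
  {q | ∀ i, ∃ j, i < j ∧ ρ j = q}

/-- The parity condition: the least priority of all states occurring infinitely often is even. -/
def ParityCond {Q : Type*} (p : Q → ℕ) (ρ : ℕ → Q) : Prop :=
  ∃ m, IsLeast (p '' infOcc ρ) m ∧ Even m

/-- A parity automaton. -/
structure ParityAutomaton (Γ Q : Type*) extends Automaton Γ Q where
  priority : Q → ℕ

/-- The language of a parity automaton. -/
def ParityAutomaton.language {Γ Q : Type*} (A : ParityAutomaton Γ Q) : Set (ℕ → Γ) :=
  {w | ParityCond A.priority (A.run w)}

/-- A safety automaton is a parity automaton with priorities `0` and `1` only and without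
transitions from priority-`1` states to priority-`0` states. -/
def ParityAutomaton.IsSafety {Γ Q : Type*} (A : ParityAutomaton Γ Q) : Prop :=
  (∀ q, A.priority q = 0 ∨ A.priority q = 1) ∧
    ∀ q σ, A.priority q = 1 → A.priority (A.next q σ) ≠ 0

/-- A mean-payoff automaton: an automaton whose transitions carry rewards. -/
structure MeanPayoffAutomaton (Γ Q : Type*) extends Automaton Γ Q where
  reward : Q → Γ → ℕ

/-- The long-run average `liminf (1/n) ∑_{i<n} x i` of a sequence of real numbers; it is only
used for bounded sequences. -/
def longRunAvg (x : ℕ → ℝ) : ℝ :=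
  liminf (fun n : ℕ => (∑ i ∈ Finset.range n, x i) / n) atTop

/-- The quantitative language of a mean-payoff automaton. -/
def MeanPayoffAutomaton.language {Γ Q : Type*} (B : MeanPayoffAutomaton Γ Q) (w : ℕ → Γ) : ℝ :=
  longRunAvg fun i => (B.reward (B.run w i) (w i) : ℝ)

/-! ### State machines -/

/-- A letter over a set `V` of Boolean signals. -/
abbrev Letter (V : Type*) := Set V

/-- The union `σ ∪ τ` of an input letter and an output letter, a letter of the joint alphabet
(`Sum` is the disjoint union of input and output signals). -/
def joint {I O : Type*} (σ : Letter I) (τ : Letter O) : Letter (I ⊕ O) :=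
  Sum.inl '' σ ∪ Sum.inr '' τ

/-- A state machine with input signals `I`, output signals `O` and state set `Q`
(finite or infinite). -/
structure StateMachine (I O Q : Type*) extends Automaton (Letter I) Q where
  out : Q → Letter I → Letter O

/-- The output letter that the machine produces at time `k` on the input word `w`. -/
def StateMachine.output {I O Q : Type*} (M : StateMachine I O Q) (w : ℕ → Letter I) (k : ℕ) :
    Letter O :=
  M.out (M.run w k) (w k)

/-- The outcome of a machine on an infinite input word. -/
def StateMachine.outcome {I O Q : Type*} (M : StateMachine I O Q) (w : ℕ → Letter I) :
    ℕ → Letter (I ⊕ O) :=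
  fun k => joint (w k) (M.output w k)

/-- `M` satisfies the qualitative specification `φ` under `μ`: the expectation of the
characteristic function of `φ` at the outcome of `M` is `1`. -/
def Satisfies {I O Q : Type*} (μ : Measure (ℕ → Letter I)) (φ : Set (ℕ → Letter (I ⊕ O)))
    (M : StateMachine I O Q) : Prop :=
  ∫ w, φ.indicator (fun _ => (1 : ℝ)) (M.outcome w) ∂μ = 1

open Classical in
/-- The value of `M` with respect to the qualitative specification `φ` and the quantitative
specification `ψ` under `μ`. -/
def machineValue {I O Q : Type*} (μ : Measure (ℕ → Letter I)) (φ : Set (ℕ → Letter (I ⊕ O)))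
    (ψ : (ℕ → Letter (I ⊕ O)) → ℝ) (M : StateMachine I O Q) : EReal :=
  if Satisfies μ φ M then ((∫ w, ψ (M.outcome w) ∂μ : ℝ) : EReal) else ⊥

/-- `M` has the greatest value with respect to `φ` and `ψ` under `μ` among all state machines
(finite or infinite). -/
def Optimizes.{v, a, b, c} {I : Type a} {O : Type b} {Q : Type c} (μ : Measure (ℕ → Letter I))
    (φ : Set (ℕ → Letter (I ⊕ O))) (ψ : (ℕ → Letter (I ⊕ O)) → ℝ)
    (M : StateMachine I O Q) : Prop :=
  ∀ (Q' : Type v) (M' : StateMachine I O Q'), machineValue μ φ ψ M' ≤ machineValue μ φ ψ M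

/-! ### Markov decision processes -/

/-- A Markov decision process on the state set `S`; the states outside `player` are the
probabilistic ones. -/
structure MDP (S : Type*) where
  init : S
  edge : S → S → Prop
  player : Set S
  δ : {s : S // s ∉ player} → PMF S
  edge_iff : ∀ (s : {s : S // s ∉ player}) (t : S), edge s t ↔ 0 < δ s t
  exists_edge : ∀ s, ∃ t, edge s t

/-- A (history-dependent, randomized) strategy: `move v s` is the distribution chosen after the
finite sequence `v s`. -/
structure Strategy {S : Type*} (G : MDP S) where
  move : List S → G.player → PMF S
  legal : ∀ (v : List S) (s : G.player) (t : S), 0 < move v s t → G.edge s t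

/-- Strategies that do not use randomization. -/
def Strategy.IsPure {S : Type*} {G : MDP S} (π : Strategy G) : Prop :=
  ∀ (v : List S) (s : G.player), ∃ t, π.move v s t = 1

/-- A pure finite-state strategy: it is represented by a finite memory `K` with initial content
`k₀`, an update function that reads the states of the play, and a choice of moves. -/
def Strategy.IsPureFiniteState {S : Type*} {G : MDP S} (π : Strategy G) : Prop :=
  ∃ (K : Type) (_ : Finite K) (k₀ : K) (upd : K → S → K) (mv : K → S → S),
    ∀ (v : List S) (s : G.player), π.move v s (mv (v.foldl upd k₀) s) = 1

open Classical in
/-- The distribution of the successor of `s` after the history `v s` under the strategy `π`. -/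
def Strategy.step {S : Type*} {G : MDP S} (π : Strategy G) (v : List S) (s : S) : PMF S :=
  if h : s ∈ G.player then π.move v ⟨s, h⟩ else G.δ ⟨s, h⟩

/-- The transition kernel from histories `h 0 … h n` to the next state, where `step v s` is the
distribution of the successor after the history `v s`. -/
def stepKernel {S : Type*} [Finite S] [MeasurableSpace S] [DiscreteMeasurableSpace S]
    (step : List S → S → PMF S) (n : ℕ) : Kernel ((i : Finset.Iic n) → S) S where
  toFun h := (step (List.ofFn fun i : Fin n => h ⟨i, Finset.mem_Iic.2 i.2.le⟩)
    (h ⟨n, Finset.mem_Iic.2 le_rfl⟩)).toMeasure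
  measurable' := measurable_of_countable _

instance {S : Type*} [Finite S] [MeasurableSpace S] [DiscreteMeasurableSpace S]
    (step : List S → S → PMF S) (n : ℕ) : IsMarkovKernel (stepKernel step n) :=
  ⟨fun _ => by dsimp [stepKernel]; infer_instance⟩

/-- The law of the random walk from `s` with the transition probabilities `step`. -/
def walkLaw {S : Type*} [Finite S] [MeasurableSpace S] [DiscreteMeasurableSpace S]
    (step : List S → S → PMF S) (s : S) : Measure (ℕ → S) :=
  Kernel.traj (X := fun _ => S) (stepKernel step) 0 fun _ => s

/-- The probability measure on plays from the state `s` under the strategy `π`. -/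
def Strategy.playLaw {S : Type*} [Finite S] [MeasurableSpace S] [DiscreteMeasurableSpace S]
    {G : MDP S} (π : Strategy G) (s : S) : Measure (ℕ → S) :=
  walkLaw π.step s

open Classical in
/-- The expectation of a bounded function with values in `ℝ ∪ {⊥}`: it is `⊥` if the value `⊥`
has positive probability. -/
def expect {Ω : Type*} [MeasurableSpace Ω] (P : Measure Ω) (f : Ω → EReal) : EReal :=
  if P {ω | f ω = ⊥} = 0 then ((∫ ω, (f ω).toReal ∂P : ℝ) : EReal) else ⊥

/-- The expectation of the objective `f` from `s` under `π`. -/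
def Strategy.expectation {S : Type*} [Finite S] [MeasurableSpace S] [DiscreteMeasurableSpace S]
    {G : MDP S} (π : Strategy G) (s : S) (f : (ℕ → S) → EReal) : EReal :=
  expect (π.playLaw s) f

/-- The value of the objective `f` at `s`, the supremum over all strategies. -/
def MDP.value {S : Type*} [Finite S] [MeasurableSpace S] [DiscreteMeasurableSpace S]
    (G : MDP S) (f : (ℕ → S) → EReal) (s : S) : EReal :=
  ⨆ π : Strategy G, π.expectation s f

/-- `π` is optimal from `s` for the objective `f`. -/
def Strategy.IsOptimal {S : Type*} [Finite S] [MeasurableSpace S] [DiscreteMeasurableSpace S]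
    {G : MDP S} (π : Strategy G) (s : S) (f : (ℕ → S) → EReal) : Prop :=
  G.value f s = π.expectation s f

open Classical in
/-- The mean-payoff objective of a reward function with values in `ℕ ∪ {⊥}`. -/
def meanObj {S : Type*} (r : S → WithBot ℕ) (ω : ℕ → S) : EReal :=
  if ∀ i, r (ω i) ≠ ⊥ then ((longRunAvg fun i => (((r (ω i)).unbotD 0 : ℕ) : ℝ) : ℝ) : EReal) else ⊥

open Classical in
/-- The mean-payoff parity objective. -/
def meanParityObj {S : Type*} (p : S → ℕ) (r : S → WithBot ℕ) (ω : ℕ → S) : EReal :=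
  if ParityCond p ω then meanObj r ω else ⊥

/-- A labeling is deterministic if different successors of a state have different labels. -/
def MDP.Deterministic {S Γ : Type*} (G : MDP S) (lab : S → Γ) : Prop :=
  ∀ s t t', G.edge s t → G.edge s t' → lab t = lab t' → t = t'

/-- A labeling is complete if every state has a successor with every label. -/
def MDP.Complete {S Γ : Type*} (G : MDP S) (lab : S → Γ) : Prop :=
  ∀ s σ, ∃ t, G.edge s t ∧ lab t = σ

/-- Completeness of a labeling by input letters and output letters: a probabilistic state has
successors exactly for the input letters, a player-1 state exactly for the output letters. -/
def MDP.CompleteAlternating {S Γ Θ : Type*} (G : MDP S) (lab : S → Γ ⊕ Θ) : Prop :=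
  (∀ s ∉ G.player, (∀ σ, ∃ t, G.edge s t ∧ lab t = Sum.inl σ) ∧
      ∀ t, G.edge s t → ∃ σ, lab t = Sum.inl σ) ∧
    ∀ s ∈ G.player, (∀ τ, ∃ t, G.edge s t ∧ lab t = Sum.inr τ) ∧
      ∀ t, G.edge s t → ∃ τ, lab t = Sum.inr τ

/-- A Markov chain is an MDP without player-1 states. -/
structure MarkovChain (S : Type*) extends MDP S where
  player_empty : player = ∅

/-- The transition probabilities of a Markov chain. -/
def MarkovChain.prob {S : Type*} (G : MarkovChain S) (s : S) : PMF S :=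
  G.δ ⟨s, by simp [G.player_empty]⟩

/-- The measure on infinite words that a labeled Markov chain defines: the law of
`λ(s₁)λ(s₂)…` for the random walk `s₀s₁s₂…` from the initial state, each move of the chain
producing one letter. -/
def MarkovChain.wordLaw {S Γ : Type*} [Finite S] [MeasurableSpace S]
    [DiscreteMeasurableSpace S] [MeasurableSpace Γ] (G : MarkovChain S) (lab : S → Γ) :
    Measure (ℕ → Γ) :=
  (walkLaw (fun _ s => G.prob s) G.init).map fun ω n => lab (ω (n + 1))

/-! ### The product MDP -/

/-- The states of the product MDP. In `env a b s l` the chain moves; `l` stores the last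
transition of the mean-payoff automaton (its source state and the output letter), if any.
In `sys a b s` the player chooses an output letter. -/
inductive ProdState (O QA QB S : Type*) where
  | env (a : QA) (b : QB) (s : S) (l : Option (QB × Letter O)) : ProdState O QA QB S
  | sys (a : QA) (b : QB) (s : S) : ProdState O QA QB S

instance {O QA QB S : Type*} : MeasurableSpace (ProdState O QA QB S) := ⊤

instance {O QA QB S : Type*} : DiscreteMeasurableSpace (ProdState O QA QB S) :=
  ⟨fun _ => trivial⟩

instance {O QA QB S : Type*} [Finite O] [Finite QA] [Finite QB] [Finite S] :
    Finite (ProdState O QA QB S) :=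
  Finite.of_surjective
    (fun x : (QA × QB × S × Option (QB × Letter O)) ⊕ (QA × QB × S) => match x with
      | Sum.inl (a, b, s, l) => ProdState.env a b s l
      | Sum.inr (a, b, s) => ProdState.sys a b s)
    (fun y => match y with
      | .env a b s l => ⟨Sum.inl (a, b, s, l), rfl⟩
      | .sys a b s => ⟨Sum.inr (a, b, s), rfl⟩)

section Product

variable {I O QA QB S : Type*}

/-- The successor of `sys a b s` when the player chooses the output letter `τ`: both automata
read the joint letter `λ(s) ∪ τ`. -/
def respond (A : ParityAutomaton (Letter (I ⊕ O)) QA)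
    (B : MeanPayoffAutomaton (Letter (I ⊕ O)) QB) (lab : S → Letter I)
    (a : QA) (b : QB) (s : S) (τ : Letter O) : ProdState O QA QB S :=
  .env (A.next a (joint (lab s) τ)) (B.next b (joint (lab s) τ)) s (some (b, τ))

/-- The edges of the product MDP. -/
def prodEdge (A : ParityAutomaton (Letter (I ⊕ O)) QA)
    (B : MeanPayoffAutomaton (Letter (I ⊕ O)) QB) (G : MarkovChain S) (lab : S → Letter I) :
    ProdState O QA QB S → ProdState O QA QB S → Prop
  | .env a b s _, t => ∃ s', G.edge s s' ∧ t = .sys a b s'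
  | .sys a b s, t => ∃ τ, t = respond A B lab a b s τ

/-- The product MDP, which alternates between a move of the chain and a choice of an output
letter. -/
def prodMDP (A : ParityAutomaton (Letter (I ⊕ O)) QA)
    (B : MeanPayoffAutomaton (Letter (I ⊕ O)) QB) (G : MarkovChain S) (lab : S → Letter I) :
    MDP (ProdState O QA QB S) where
  init := .env A.init B.init G.init none
  edge := prodEdge A B G lab
  player := {x | ∃ a b s, x = .sys a b s}
  δ x := match x with
    | ⟨.env a b s _, _⟩ => (G.prob s).map (ProdState.sys a b)
    | ⟨.sys a b s, h⟩ => absurd ⟨a, b, s, rfl⟩ h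
  edge_iff := by
    rintro ⟨x | ⟨a, b, s⟩, h⟩ t
    · simp only [prodEdge, pos_iff_ne_zero, ← PMF.mem_support_iff, PMF.support_map, Set.mem_image]
      refine exists_congr fun s' => ?_
      rw [G.edge_iff ⟨_, by simp [G.player_empty]⟩, pos_iff_ne_zero, PMF.mem_support_iff,
        eq_comm (a := t)]
      rfl
    · exact absurd ⟨a, b, s, rfl⟩ h
  exists_edge := by
    rintro (⟨a, b, s, l⟩ | ⟨a, b, s⟩)
    · obtain ⟨s', hs'⟩ := G.exists_edge s
      exact ⟨_, s', hs', rfl⟩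
    · exact ⟨_, ∅, rfl⟩

/-- The labels of the product MDP: the input letter of the chain in the intermediate states, the
last chosen output letter in the other states (`∅` initially). -/
def prodLabel (lab : S → Letter I) : ProdState O QA QB S → Letter I ⊕ Letter O
  | .env _ _ _ none => Sum.inr ∅
  | .env _ _ _ (some (_, τ)) => Sum.inr τ
  | .sys _ _ s => Sum.inl (lab s)

/-- The priorities of the product MDP, copied from the parity automaton. -/
def prodPriority (A : ParityAutomaton (Letter (I ⊕ O)) QA) : ProdState O QA QB S → ℕ
  | .env a _ _ _ => A.priority a
  | .sys a _ _ => A.priority a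

/-- The rewards of the product MDP for a parity specification: the reward of the transition that
the mean-payoff automaton has just made, and `0` in the other states. -/
def prodReward (B : MeanPayoffAutomaton (Letter (I ⊕ O)) QB) (lab : S → Letter I) :
    ProdState O QA QB S → WithBot ℕ
  | .env _ _ _ none => ((0 : ℕ) : WithBot ℕ)
  | .env _ _ s (some (b, τ)) => ((B.reward b (joint (lab s) τ) : ℕ) : WithBot ℕ)
  | .sys _ _ _ => ((0 : ℕ) : WithBot ℕ)

open Classical in
/-- The rewards of the product MDP for a safety specification: as before, but `⊥` in the states of
priority `1`. -/
def prodRewardSafety (A : ParityAutomaton (Letter (I ⊕ O)) QA)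
    (B : MeanPayoffAutomaton (Letter (I ⊕ O)) QB) (lab : S → Letter I)
    (x : ProdState O QA QB S) : WithBot ℕ :=
  if prodPriority A x = 1 then ⊥ else prodReward B lab x

end Product

/-! ### Strategies and state machines -/

/-- The sequence `ω` is a play from the initial state that is consistent with the strategy `π`. -/
def Strategy.Consistent {S : Type*} {G : MDP S} (π : Strategy G) (ω : ℕ → S) : Prop :=
  ω 0 = G.init ∧
    ∀ n, 0 < π.step (List.ofFn fun i : Fin n => ω i) (ω n) (ω (n + 1))

/-- A strategy in an MDP whose plays carry input letters at the odd positions and output letters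
at the positive even positions corresponds to the machine `M` if, for every input word `w`, there
is a play consistent with the strategy whose inputs are `w`, and on every such play the outputs
are those of `M` on `w`. -/
def Corresponds {I O S Q : Type*} {G : MDP S} (lab : S → Letter I ⊕ Letter O) (π : Strategy G)
    (M : StateMachine I O Q) : Prop :=
  ∀ w : ℕ → Letter I,
    (∃ ω, π.Consistent ω ∧ ∀ k, lab (ω (2 * k + 1)) = Sum.inl (w k)) ∧
    ∀ ω, π.Consistent ω → (∀ k, lab (ω (2 * k + 1)) = Sum.inl (w k)) →
      ∀ k, lab (ω (2 * k + 2)) = Sum.inr (M.output w k)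

end

end QSynth

open QSynth

universe v

/-! The product MDP is a game encoding of state machines, and the proof is an exact dictionary
between the two. A walk of the chain together with a sequence of output letters determines a play
(`prodPlay`). On such a play each admissible objective equals half of the `B`-value of the joint
word if that word lies in the language of `A`, and `⊥` otherwise. The factor is one half because
only every second state of a play carries a reward.

A strategy realizes a machine if, along every walk of the chain, it plays the machine's outputs with
probability one. The law of its plays is then the image of the law of the walks
(`Realizes.playLaw_eq`), so its expectation is half of the machine's value, with `⊥` exactly when
the machine violates the specification (`Realizes.expectation_eq`).

The dictionary works in both directions. Every machine is realized by the strategy that simulates it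
on the history (`StateMachine.realizes_toStrategy`). Conversely, every pure strategy is realized by
a machine (`exists_realizes_of_isPure`): since the labels of the chain are deterministic and
complete, the input letter reveals the next state of the chain, and a machine can therefore track
the whole play.

Optimality now transfers: a competing machine becomes a competing strategy, whose expectation is at
most that of `π`. Randomized strategies need no analysis, because `π` is only compared with
strategies that come from machines. -/

namespace QSynth

/-! ### Laws of random walks on a finite set -/

section WalkLaw

theorem setOf_prefix_eq {S : Type*} (n : ℕ) (h : ℕ → S) :
    {ω : ℕ → S | ∀ i ≤ n, ω i = h i} =
      Preorder.frestrictLe (π := fun _ => S) n ⁻¹' {Preorder.frestrictLe (π := fun _ => S) n h} := by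
  ext ω
  simp only [Set.mem_ofPred_eq, Set.mem_preimage, Set.mem_singleton_iff, funext_iff]
  simp

variable {S : Type*} [Finite S] [MeasurableSpace S] [DiscreteMeasurableSpace S]

instance (step : List S → S → PMF S) (s : S) : IsProbabilityMeasure (walkLaw step s) := by
  unfold walkLaw; infer_instance

theorem measurableSet_prefix (n : ℕ) (h : ℕ → S) :
    MeasurableSet {ω : ℕ → S | ∀ i ≤ n, ω i = h i} := by
  rw [setOf_prefix_eq]
  exact (Preorder.measurable_frestrictLe n) (MeasurableSet.of_discrete)

theorem walkLaw_prefix (step : List S → S → PMF S) (s : S) (n : ℕ) (h : ℕ → S) :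
    walkLaw step s {ω | ∀ i ≤ n, ω i = h i} =
      Kernel.partialTraj (X := fun _ => S) (stepKernel step) 0 n (fun _ => s)
        {Preorder.frestrictLe (π := fun _ => S) n h} := by
  rw [setOf_prefix_eq, walkLaw, ← Kernel.traj_map_frestrictLe_apply,
    Measure.map_apply (Preorder.measurable_frestrictLe n) MeasurableSet.of_discrete]

theorem walkLaw_prefix_zero_of_ne (step : List S → S → PMF S) {s : S} {h : ℕ → S} (hs : h 0 ≠ s) :
    walkLaw step s {ω | ∀ i ≤ 0, ω i = h i} = 0 := by
  rw [walkLaw_prefix, Kernel.partialTraj_self, Kernel.id_apply,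
    Measure.dirac_apply' _ MeasurableSet.of_discrete]
  simp only [Set.indicator_apply_eq_zero, Set.mem_singleton_iff, Pi.one_apply, one_ne_zero, imp_false]
  intro e
  exact hs (congrFun e ⟨0, by simp⟩).symm

theorem walkLaw_prefix_zero (step : List S → S → PMF S) {s : S} {h : ℕ → S} (hs : h 0 = s) :
    walkLaw step s {ω | ∀ i ≤ 0, ω i = h i} = 1 := by
  rw [walkLaw_prefix, Kernel.partialTraj_self, Kernel.id_apply,
    Measure.dirac_apply' _ MeasurableSet.of_discrete, Set.indicator_of_mem]
  · rfl
  · ext ⟨i, hi⟩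
    obtain rfl : i = 0 := by simpa using hi
    exact hs.symm

/-- Chain rule. The trajectory up to `n + 1` appends one draw from `stepKernel` to the trajectory up
to `n`; on a single prefix the integrand is constant, so the integral factors. -/
theorem walkLaw_prefix_succ (step : List S → S → PMF S) (s : S) (n : ℕ) (h : ℕ → S) :
    walkLaw step s {ω | ∀ i ≤ n + 1, ω i = h i} =
      walkLaw step s {ω | ∀ i ≤ n, ω i = h i} *
        step (List.ofFn fun i : Fin n => h i) (h n) (h (n + 1)) := by
  rw [walkLaw_prefix, walkLaw_prefix, Kernel.partialTraj_succ_of_le (Nat.zero_le n),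
    Kernel.map_apply' _ (by fun_prop) _ MeasurableSet.of_discrete,
    Kernel.comp_apply' _ _ _ MeasurableSet.of_discrete]
  have hpre : IicProdIoc (X := fun _ => S) n (n + 1) ⁻¹'
        {Preorder.frestrictLe (π := fun _ => S) (n + 1) h} =
      {Preorder.frestrictLe (π := fun _ => S) n h} ×ˢ
        (MeasurableEquiv.piSingleton (X := fun _ => S) n '' {h (n + 1)}) := by
    ext ⟨x, y⟩
    simp only [Set.mem_preimage, Set.mem_singleton_iff, Set.mem_prod, Set.image_singleton]
    constructor
    · intro e
      constructor
      · ext ⟨i, hi⟩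
        have hi' := Finset.mem_Iic.1 hi
        have := congrFun e ⟨i, Finset.mem_Iic.2 (by omega)⟩
        simpa [IicProdIoc, hi'] using this
      · ext ⟨i, hi⟩
        obtain rfl : i = n + 1 := by have := Finset.mem_Ioc.1 hi; omega
        have := congrFun e ⟨n + 1, by simp⟩
        simpa [IicProdIoc, MeasurableEquiv.piSingleton] using this
    · rintro ⟨rfl, rfl⟩
      ext ⟨i, hi⟩
      have hi' := Finset.mem_Iic.1 hi
      rcases Nat.lt_or_ge n i with h1 | h1
      · obtain rfl : i = n + 1 := by omega
        simp [IicProdIoc, MeasurableEquiv.piSingleton]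
      · simp [IicProdIoc, h1]
  rw [hpre]
  have hint : ∀ x : (i : Finset.Iic n) → S,
      (Kernel.id ×ₖ (stepKernel step n).map (MeasurableEquiv.piSingleton (X := fun _ => S) n)) x
        ({Preorder.frestrictLe (π := fun _ => S) n h} ×ˢ
          (MeasurableEquiv.piSingleton (X := fun _ => S) n '' {h (n + 1)})) =
      ({Preorder.frestrictLe (π := fun _ => S) n h} : Set _).indicator
        (fun _ => step (List.ofFn fun i : Fin n => h i) (h n) (h (n + 1))) x := by
    intro x
    have := Kernel.IsMarkovKernel.map (stepKernel step n)
      (MeasurableEquiv.piSingleton (X := fun _ => S) n).measurable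
    rw [Kernel.prod_apply_prod, Kernel.id_apply,
      Measure.dirac_apply' _ MeasurableSet.of_discrete,
      Kernel.map_apply' _ (MeasurableEquiv.measurable _) _ MeasurableSet.of_discrete,
      Set.preimage_image_eq _ (MeasurableEquiv.injective _)]
    by_cases hx : x = Preorder.frestrictLe (π := fun _ => S) n h
    · subst hx
      simp only [Set.mem_singleton_iff, Set.indicator_of_mem, Pi.one_apply, one_mul]
      change (PMF.toMeasure _) _ = _
      rw [PMF.toMeasure_apply_singleton _ _ MeasurableSet.of_discrete]
      rfl
    · simp [hx]
  simp_rw [hint]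
  rw [lintegral_indicator MeasurableSet.of_discrete, setLIntegral_const, mul_comm]

/-- A probability measure on sequences over a finite set is determined by lower bounds for the
probabilities of arbitrarily long prefixes. -/
theorem measure_eq_of_prefix_le {P P' : Measure (ℕ → S)} [IsProbabilityMeasure P]
    [IsProbabilityMeasure P']
    (hle : ∀ (n : ℕ) (h : ℕ → S), P {ω | ∀ i ≤ 2 * n, ω i = h i} ≤
      P' {ω | ∀ i ≤ 2 * n, ω i = h i}) : P = P' := by
  have hm (n : ℕ) : Measurable (Preorder.frestrictLe (π := fun _ => S) n) :=
    Preorder.measurable_frestrictLe n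
  have heven (n : ℕ) : P.map (Preorder.frestrictLe (2 * n)) =
      P'.map (Preorder.frestrictLe (2 * n)) := by
    have h1 : IsProbabilityMeasure (P.map (Preorder.frestrictLe (π := fun _ => S) (2 * n))) :=
      Measure.isProbabilityMeasure_map (hm _).aemeasurable
    have h2 : IsProbabilityMeasure (P'.map (Preorder.frestrictLe (π := fun _ => S) (2 * n))) :=
      Measure.isProbabilityMeasure_map (hm _).aemeasurable
    -- Equal total mass turns domination into equality. On a finite space it suffices to compare the
    -- masses of points.
    refine Measure.eq_of_le_of_isProbabilityMeasure (Measure.le_iff.2 fun s _ => ?_)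
    have hs : s = ⋃ x ∈ s.toFinite.toFinset, {x} := by ext; simp
    have hd : Set.PairwiseDisjoint (s.toFinite.toFinset : Set ((i : Finset.Iic (2 * n)) → S))
        fun x => ({x} : Set _) :=
      fun _ _ _ _ h => Set.disjoint_singleton.2 h
    have hd' : ∀ x ∈ s.toFinite.toFinset, MeasurableSet ({x} : Set ((i : Finset.Iic (2 * n)) → S)) :=
      fun _ _ => MeasurableSet.of_discrete
    rw [hs, measure_biUnion_finset hd hd', measure_biUnion_finset hd hd']
    refine Finset.sum_le_sum fun x _ => ?_
    rw [Measure.map_apply (hm _) MeasurableSet.of_discrete,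
      Measure.map_apply (hm _) MeasurableSet.of_discrete]
    -- A finite tuple is a prefix of the sequence that stays constant after index `2 * n`.
    have hx : x = Preorder.frestrictLe (π := fun _ => S) (2 * n)
        (fun i => x ⟨min i (2 * n), by simp⟩) := by
      ext ⟨i, hi⟩
      simp [Finset.mem_Iic.1 hi]
    rw [hx, ← setOf_prefix_eq]
    exact hle _ _
  have hall (J : Finset ℕ) : P.map J.restrict = P'.map J.restrict := by
    have hJ : J ⊆ Finset.Iic (2 * J.sup id) := fun i hi => by
      have := Finset.le_sup (f := id) hi
      simp only [id, Finset.mem_Iic] at this ⊢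
      omega
    have e : J.restrict (π := fun _ => S) =
      Finset.restrict₂ (π := fun _ => S) hJ ∘ Preorder.frestrictLe (2 * J.sup id) := rfl
    have hr := Finset.measurable_restrict₂ (X := fun _ : ℕ => S) hJ
    rw [e, ← Measure.map_map hr (hm _), heven, Measure.map_map hr (hm _)]
  have hP : IsProjectiveLimit P (fun J => P'.map J.restrict) := hall
  exact hP.unique fun _ => rfl

end WalkLaw

/-! ### Long-run averages and parity conditions -/

section Average

/-- The average of the first `n` terms of `y` is `c n` times an average of `x`, where `c n` tends to
`1 / 2` and the index `(n - 1) / 2` runs through all naturals in order. Nonnegativity and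
boundedness allow the convergent factor to be pulled out of the liminf. -/
theorem longRunAvg_interleave_zero {x y : ℕ → ℝ} {C : ℝ} (hx : ∀ n, 0 ≤ x n) (hC : ∀ n, x n ≤ C)
    (h0 : y 0 = 0) (hodd : ∀ k, y (2 * k + 1) = 0) (heven : ∀ k, y (2 * k + 2) = x k) :
    longRunAvg y = longRunAvg x / 2 := by
  set u : ℕ → ℝ := fun n => (∑ i ∈ Finset.range n, x i) / n with hu
  set c : ℕ → ℝ := fun n => (((n - 1) / 2 : ℕ) : ℝ) / n with hc
  have hsum_odd (m : ℕ) : ∑ i ∈ Finset.range (2 * m + 1), y i = ∑ i ∈ Finset.range m, x i := by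
    induction m with
    | zero => simp [h0]
    | succ m ih =>
      rw [show 2 * (m + 1) + 1 = 2 * m + 1 + 1 + 1 by ring, Finset.sum_range_succ,
        Finset.sum_range_succ, ih, hodd, Finset.sum_range_succ, add_zero]
      congr 1
      exact heven m
  -- The first `n` positions contain `(n - 1) / 2` entries of `x`, because these start only at
  -- position 2.
  have hsum (n : ℕ) : ∑ i ∈ Finset.range n, y i = ∑ i ∈ Finset.range ((n - 1) / 2), x i := by
    rcases Nat.eq_zero_or_pos n with rfl | hn
    · simp
    obtain h | h : n = 2 * ((n - 1) / 2) + 1 ∨ n = 2 * ((n - 1) / 2) + 1 + 1 := by omega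
    · conv_lhs => rw [h, hsum_odd]
    · conv_lhs => rw [h, Finset.sum_range_succ, hsum_odd, hodd, add_zero]
  have hprod : (fun n : ℕ => (∑ i ∈ Finset.range n, y i) / n) =
      c * fun n => u ((n - 1) / 2) := by
    funext n
    simp only [hsum, hc, hu, Pi.mul_apply]
    rcases Nat.eq_zero_or_pos ((n - 1) / 2) with h | h
    · simp [h]
    · have : (((n - 1) / 2 : ℕ) : ℝ) ≠ 0 := by positivity
      field_simp
  have hu0 (n : ℕ) : 0 ≤ u n := div_nonneg (Finset.sum_nonneg fun i _ => hx i) n.cast_nonneg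
  have huC (n : ℕ) : u n ≤ C := by
    have hC0 : 0 ≤ C := (hx 0).trans (hC 0)
    refine div_le_of_le_mul₀ n.cast_nonneg hC0 ?_
    calc ∑ i ∈ Finset.range n, x i ≤ ∑ _i ∈ Finset.range n, C := Finset.sum_le_sum fun i _ => hC i
      _ = C * n := by simp [mul_comm]
  have hct : Tendsto c atTop (nhds (1 / 2)) := by
    have h1 : Tendsto (fun n : ℕ => (1 / 2 : ℝ) - 1 / n) atTop (nhds (1 / 2)) := by
      simpa using (tendsto_const_nhds (x := (1 / 2 : ℝ))).sub tendsto_one_div_atTop_nhds_zero_nat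
    refine tendsto_of_tendsto_of_tendsto_of_le_of_le' h1 tendsto_const_nhds ?_ ?_
    · filter_upwards [eventually_gt_atTop 0] with n hn
      have hn' : (0 : ℝ) < n := by exact_mod_cast hn
      have : (n : ℝ) ≤ 2 * ((n - 1) / 2 : ℕ) + 2 := by
        have : n ≤ 2 * ((n - 1) / 2) + 2 := by omega
        exact_mod_cast this
      simp only [hc]
      rw [div_sub_div _ _ two_ne_zero hn'.ne', div_le_div_iff₀ (by positivity) hn']
      nlinarith
    · filter_upwards [eventually_gt_atTop 0] with n hn
      have hn' : (0 : ℝ) < n := by exact_mod_cast hn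
      have : 2 * (((n - 1) / 2 : ℕ) : ℝ) ≤ n := by
        have : 2 * ((n - 1) / 2) ≤ n := by omega
        exact_mod_cast this
      simp only [hc]
      rw [div_le_div_iff₀ hn' two_pos]
      linarith
  have hmap : map (fun n : ℕ => (n - 1) / 2) atTop = atTop := by
    have : (fun n : ℕ => (n - 1) / 2) = (fun n => n / 2) ∘ fun n => n - 1 := rfl
    rw [this, ← map_map, map_sub_atTop_eq_nat, map_div_atTop_eq_nat 2 two_pos]
  -- The reparametrization maps `atTop` onto `atTop`, so it does not change the liminf.
  have hlim : liminf (fun n => u ((n - 1) / 2)) atTop = liminf u atTop := by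
    conv_rhs => rw [← hmap]
    rfl
  have hc0 : 0 ≤ᶠ[atTop] c := Eventually.of_forall fun n => by positivity
  have hv0 : 0 ≤ᶠ[atTop] fun n => u ((n - 1) / 2) := Eventually.of_forall fun n => hu0 _
  have hvb : IsBoundedUnder (· ≤ ·) atTop fun n => u ((n - 1) / 2) :=
    isBoundedUnder_of ⟨C, fun n => huC _⟩
  have key : liminf (c * fun n => u ((n - 1) / 2)) atTop = 1 / 2 * liminf u atTop := by
    apply le_antisymm
    · have := liminf_mul_le (f := atTop) hc0 hct.isBoundedUnder_le hv0 hvb.isCoboundedUnder_ge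
      rwa [hct.limsup_eq, hlim] at this
    · have := le_liminf_mul (f := atTop) hc0 hct.isBoundedUnder_le hv0 hvb.isCoboundedUnder_ge
      rwa [hct.liminf_eq, hlim] at this
  unfold longRunAvg
  rw [hprod, key]
  ring

end Average

section Parity

/-- Pigeonhole: if no state over `m` recurred, finitely many "eventually never" statements would
combine to exclude `m`. This makes parity a property of the priority sequence alone, so runs over
different state spaces can be compared. -/
theorem image_infOcc {Q R : Type*} [Finite Q] (p : Q → R) (ρ : ℕ → Q) :
    p '' infOcc ρ = infOcc fun n => p (ρ n) := by
  ext m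
  constructor
  · rintro ⟨q, hq, rfl⟩ i
    obtain ⟨j, hj, rfl⟩ := hq i
    exact ⟨j, hj, rfl⟩
  · intro hm
    have hf : ∃ᶠ j in atTop, ∃ q ∈ p ⁻¹' {m}, ρ j = q :=
      frequently_atTop'.2 fun i => by
        obtain ⟨j, hj, h⟩ := hm i
        exact ⟨j, hj, ρ j, h, rfl⟩
    by_contra hcon
    have hq : ∀ q, q ∈ p ⁻¹' {m} → ∀ᶠ j in atTop, ρ j ≠ q := by
      intro q hq
      by_contra hne
      refine hcon ⟨q, fun i => ?_, hq⟩
      have : ∃ᶠ j in atTop, ρ j = q := fun h => hne h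
      obtain ⟨j, hj, h⟩ := frequently_atTop'.1 this i
      exact ⟨j, hj, h⟩
    have hall : ∀ᶠ j in atTop, ∀ q, q ∈ p ⁻¹' {m} → ρ j ≠ q :=
      eventually_all.2 fun q => by
        by_cases h : q ∈ p ⁻¹' {m}
        · filter_upwards [hq q h] with j hj _ using hj
        · exact Eventually.of_forall fun _ h' => absurd h' h
    exact hf (hall.mono fun j hj ⟨q, hqm, h⟩ => hj q hqm h)

theorem parityCond_iff {Q : Type*} [Finite Q] (p : Q → ℕ) (ρ : ℕ → Q) :
    ParityCond p ρ ↔ ∃ m, IsLeast (infOcc fun n => p (ρ n)) m ∧ Even m := by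
  rw [ParityCond, image_infOcc]

/-- In a play of the product each state of `A` persists for two positions, which does not affect
recurrence. -/
theorem infOcc_double {R : Type*} {x y : ℕ → R} (heven : ∀ k, y (2 * k) = x k)
    (hodd : ∀ k, y (2 * k + 1) = x k) : infOcc y = infOcc x := by
  ext q
  constructor
  · intro h i
    obtain ⟨j, hj, hq⟩ := h (2 * i + 1)
    refine ⟨j / 2, by omega, ?_⟩
    obtain h' | h' : j = 2 * (j / 2) ∨ j = 2 * (j / 2) + 1 := by omega
    · rw [← heven, ← h', hq]
    · rw [← hodd, ← h', hq]
  · intro h i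
    obtain ⟨j, hj, hq⟩ := h i
    exact ⟨2 * j, by omega, by rw [heven, hq]⟩

theorem infOcc_const_of_eventually {R : Type*} {x : ℕ → R} {c : R} {n : ℕ}
    (h : ∀ k ≥ n, x k = c) : infOcc x = {c} := by
  ext q
  constructor
  · intro hq
    obtain ⟨j, hj, rfl⟩ := hq n
    exact h j hj.le
  · rintro rfl i
    exact ⟨max (i + 1) n, by omega, h _ (le_max_right _ _)⟩

/-- Priority 1 is absorbing: once reached, it is the only recurring priority, and it is odd.
Otherwise the priority is constantly 0. -/
theorem ParityAutomaton.IsSafety.mem_language_iff {Γ Q : Type*} [Finite Q]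
    {A : ParityAutomaton Γ Q} (hA : A.IsSafety) (w : ℕ → Γ) :
    w ∈ A.language ↔ ∀ k, A.priority (A.run w k) ≠ 1 := by
  rw [ParityAutomaton.language, Set.mem_ofPred_eq, parityCond_iff]
  constructor
  · rintro ⟨m, hm, hev⟩ k hk
    have hall : ∀ j ≥ k, A.priority (A.run w j) = 1 := by
      intro j hj
      induction j, hj using Nat.le_induction with
      | base => exact hk
      | succ j _ ih => exact (hA.1 _).resolve_left (hA.2 _ _ ih)
    rw [infOcc_const_of_eventually hall] at hm
    rw [hm.unique isLeast_singleton] at hev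
    exact absurd hev (by decide)
  · intro h
    have hall : ∀ j ≥ 0, A.priority (A.run w j) = 0 := fun j _ => (hA.1 _).resolve_right (h j)
    rw [infOcc_const_of_eventually hall]
    exact ⟨0, isLeast_singleton, by decide⟩

end Parity

/-! ### Measurability of objectives -/

section Measurability

theorem Measurable.longRunAvg {Ω : Type*} [MeasurableSpace Ω] {x : Ω → ℕ → ℝ}
    (hx : ∀ n, Measurable fun ω => x ω n) : Measurable fun ω => longRunAvg (x ω) := by
  unfold QSynth.longRunAvg
  exact Measurable.liminf fun n =>
    (Finset.measurable_sum _ fun i _ => hx i).div_const _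

theorem measurable_meanObj {S : Type*} [MeasurableSpace S] [DiscreteMeasurableSpace S]
     (r : S → WithBot ℕ) : Measurable (meanObj r) := by
  have hm (n : ℕ) : Measurable fun ω : ℕ → S => ω n := measurable_pi_apply n
  refine Measurable.ite ?_ ?_ measurable_const
  · rw [Set.ofPred_forall]
    exact MeasurableSet.iInter fun i => hm i (MeasurableSet.of_discrete (s := {s | r s ≠ ⊥}))
  · exact measurable_coe_real_ereal.comp (Measurable.longRunAvg fun n =>
      (Measurable.of_discrete (f := fun s => (((r s).unbotD 0 : ℕ) : ℝ))).comp (hm n))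

variable {S : Type*} [Finite S] [MeasurableSpace S] [DiscreteMeasurableSpace S]

/-- The condition factors through the set of recurring states, an element of a finite, hence
discrete, power set. -/
theorem measurableSet_parityCond (p : S → ℕ) : MeasurableSet {ω : ℕ → S | ParityCond p ω} := by
  have hinf : Measurable (infOcc : (ℕ → S) → Set S) := by
    refine measurable_set_iff.2 fun q => Measurable.forall fun i => Measurable.exists fun j => ?_
    exact (Measurable.of_discrete (f := fun s => i < j ∧ s = q)).comp (measurable_pi_apply j)
  exact hinf (MeasurableSet.of_discrete (s := {T | ∃ m, IsLeast (p '' T) m ∧ Even m}))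

theorem measurable_meanParityObj (p : S → ℕ) (r : S → WithBot ℕ) :
    Measurable (meanParityObj p r) :=
  Measurable.ite (measurableSet_parityCond p) (measurable_meanObj r) measurable_const

end Measurability

/-! ### Plays of the product MDP -/

/-- The state space may be uncountable, as infinite machines are allowed. Countability of the
alphabet already makes the transition function measurable on the product. -/
theorem Automaton.measurable_run {Γ Q : Type*} [Countable Γ] [MeasurableSpace Γ]
    [DiscreteMeasurableSpace Γ] [MeasurableSpace Q] [DiscreteMeasurableSpace Q]
    (A : Automaton Γ Q) (n : ℕ) : Measurable fun w => A.run w n := by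
  induction n with
  | zero => exact measurable_const
  | succ n ih =>
    have hnext : Measurable fun x : Q × Γ => A.next x.1 x.2 :=
      measurable_from_prod_countable_left fun _ => Measurable.of_discrete
    exact hnext.comp (ih.prodMk (measurable_pi_apply n))

theorem StateMachine.measurable_output {I O Q : Type*} [Finite I] (M : StateMachine I O Q)
    (k : ℕ) : Measurable fun w => M.output w k := by
  let : MeasurableSpace Q := ⊤
  have : DiscreteMeasurableSpace Q := ⟨fun _ => trivial⟩
  have hout : Measurable fun x : Q × Letter I => M.out x.1 x.2 :=
    measurable_from_prod_countable_left fun _ => Measurable.of_discrete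
  exact hout.comp ((M.toAutomaton.measurable_run k).prodMk (measurable_pi_apply k))

theorem StateMachine.measurable_outcome {I O Q : Type*} [Finite I] [Finite O]
    (M : StateMachine I O Q) : Measurable M.outcome :=
  measurable_pi_lambda _ fun k =>
    (Measurable.of_discrete (f := fun x : Letter I × Letter O => joint x.1 x.2)).comp
      ((measurable_pi_apply k).prodMk (M.measurable_output k))

theorem ParityAutomaton.measurableSet_language {Γ Q : Type*} [Countable Γ] [MeasurableSpace Γ]
    [DiscreteMeasurableSpace Γ] [Finite Q] (A : ParityAutomaton Γ Q) :
    MeasurableSet A.language := by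
  let : MeasurableSpace Q := ⊤
  have : DiscreteMeasurableSpace Q := ⟨fun _ => trivial⟩
  exact measurable_pi_lambda _ A.toAutomaton.measurable_run (measurableSet_parityCond A.priority)

theorem MeanPayoffAutomaton.measurable_language {Γ Q : Type*} [Countable Γ] [MeasurableSpace Γ]
    [DiscreteMeasurableSpace Γ] [Countable Q] (B : MeanPayoffAutomaton Γ Q) :
    Measurable B.language := by
  let : MeasurableSpace Q := ⊤
  have : DiscreteMeasurableSpace Q := ⟨fun _ => trivial⟩
  exact Measurable.longRunAvg fun n =>
    (Measurable.of_discrete (f := fun x : Q × Γ => (B.reward x.1 x.2 : ℝ))).comp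
      ((B.toAutomaton.measurable_run n).prodMk (measurable_pi_apply n))

section Plays

variable {I O QA QB S : Type*}

/-- The word over the joint alphabet for a walk `s` of the chain and a sequence `τ` of output
letters. -/
def jointWord (lab : S → Letter I) (s : ℕ → S) (τ : ℕ → Letter O) : ℕ → Letter (I ⊕ O) :=
  fun k => joint (lab (s (k + 1))) (τ k)

/-- The play of the product MDP for a walk `s` of the chain and a sequence `τ` of output
letters. -/
def prodPlay (A : ParityAutomaton (Letter (I ⊕ O)) QA)
    (B : MeanPayoffAutomaton (Letter (I ⊕ O)) QB) (lab : S → Letter I) (s : ℕ → S)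
    (τ : ℕ → Letter O) (n : ℕ) : ProdState O QA QB S :=
  if n % 2 = 1 then
    .sys (A.run (jointWord lab s τ) (n / 2)) (B.run (jointWord lab s τ) (n / 2)) (s (n / 2 + 1))
  else match n / 2 with
    | 0 => .env A.init B.init (s 0) none
    | k + 1 => respond A B lab (A.run (jointWord lab s τ) k) (B.run (jointWord lab s τ) k)
        (s (k + 1)) (τ k)

variable (A : ParityAutomaton (Letter (I ⊕ O)) QA)
  (B : MeanPayoffAutomaton (Letter (I ⊕ O)) QB) (lab : S → Letter I) (s : ℕ → S)
  (τ : ℕ → Letter O)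

theorem prodPlay_zero : prodPlay A B lab s τ 0 = .env A.init B.init (s 0) none := rfl

theorem prodPlay_odd (k : ℕ) : prodPlay A B lab s τ (2 * k + 1) =
    .sys (A.run (jointWord lab s τ) k) (B.run (jointWord lab s τ) k) (s (k + 1)) := by
  have h1 : (2 * k + 1) % 2 = 1 := by omega
  have h2 : (2 * k + 1) / 2 = k := by omega
  simp only [prodPlay, h1, h2, if_true]

theorem prodPlay_even_succ (k : ℕ) : prodPlay A B lab s τ (2 * k + 2) =
    respond A B lab (A.run (jointWord lab s τ) k) (B.run (jointWord lab s τ) k)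
      (s (k + 1)) (τ k) := by
  have h1 : ¬ (2 * k + 2) % 2 = 1 := by omega
  have h2 : (2 * k + 2) / 2 = k + 1 := by omega
  simp only [prodPlay, h1, h2, if_false]

/-- The memory `l` is left unspecified because the next move of the chain does not depend on it;
this treats the initial state and the later ones alike. -/
theorem prodPlay_even (k : ℕ) : ∃ l, prodPlay A B lab s τ (2 * k) =
    .env (A.run (jointWord lab s τ) k) (B.run (jointWord lab s τ) k) (s k) l := by
  cases k with
  | zero => exact ⟨_, rfl⟩
  | succ k => exact ⟨_, prodPlay_even_succ A B lab s τ k⟩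

theorem parityCond_prodPlay [Finite O] [Finite QA] [Finite QB] [Finite S] :
    ParityCond (prodPriority A) (prodPlay A B lab s τ) ↔ jointWord lab s τ ∈ A.language := by
  rw [parityCond_iff, ParityAutomaton.language, Set.mem_ofPred_eq, parityCond_iff,
    infOcc_double (x := fun k => A.priority (A.run (jointWord lab s τ) k))]
  · intro k
    obtain ⟨l, hl⟩ := prodPlay_even A B lab s τ k
    rw [hl]; rfl
  · intro k
    rw [prodPlay_odd]; rfl

theorem prodReward_ne_bot (x : ProdState O QA QB S) : prodReward B lab x ≠ ⊥ := by
  rcases x with ⟨a, b, s, _ | ⟨b', τ⟩⟩ | ⟨a, b, s⟩ <;> exact WithBot.coe_ne_bot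

theorem longRunAvg_prodPlay [Finite I] [Finite O] [Finite QB] :
    longRunAvg (fun i => (((prodReward B lab (prodPlay A B lab s τ i)).unbotD 0 : ℕ) : ℝ)) =
      B.language (jointWord lab s τ) / 2 := by
  -- There are finitely many transitions of `B`, so the rewards are bounded.
  obtain ⟨C, hC⟩ := (Set.finite_range fun x : QB × Letter (I ⊕ O) => B.reward x.1 x.2).bddAbove
  refine longRunAvg_interleave_zero (C := C) (fun n => Nat.cast_nonneg _)
    (fun n => Nat.cast_le.2 (hC ⟨(_, _), rfl⟩)) ?_ (fun k => ?_) fun k => ?_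
  · rw [prodPlay_zero]
    exact Nat.cast_zero
  · rw [prodPlay_odd]
    exact Nat.cast_zero
  · rw [prodPlay_even_succ]
    rfl

open Classical in
theorem meanParityObj_prodPlay [Finite I] [Finite O] [Finite QA] [Finite QB] [Finite S] :
    meanParityObj (prodPriority A) (prodReward B lab) (prodPlay A B lab s τ) =
      if jointWord lab s τ ∈ A.language then
        ((B.language (jointWord lab s τ) / 2 : ℝ) : EReal) else ⊥ := by
  unfold meanParityObj meanObj
  rw [if_pos fun i => prodReward_ne_bot B lab _, longRunAvg_prodPlay]
  simp only [parityCond_prodPlay]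

open Classical in
theorem meanObj_prodRewardSafety_prodPlay [Finite I] [Finite O] [Finite QA] [Finite QB]
    (hA : A.IsSafety) :
    meanObj (prodRewardSafety A B lab) (prodPlay A B lab s τ) =
      if jointWord lab s τ ∈ A.language then
        ((B.language (jointWord lab s τ) / 2 : ℝ) : EReal) else ⊥ := by
  have hiff : (∀ i, prodRewardSafety A B lab (prodPlay A B lab s τ i) ≠ ⊥) ↔
      ∀ i, prodPriority A (prodPlay A B lab s τ i) ≠ 1 := by
    refine forall_congr' fun i => ?_
    unfold prodRewardSafety
    split_ifs with h <;> simp [h, prodReward_ne_bot]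
  have hmem : jointWord lab s τ ∈ A.language ↔
      ∀ i, prodPriority A (prodPlay A B lab s τ i) ≠ 1 := by
    rw [hA.mem_language_iff]
    constructor
    · intro h i
      obtain h' | h' : i = 2 * (i / 2) ∨ i = 2 * (i / 2) + 1 := by omega
      · obtain ⟨l, hl⟩ := prodPlay_even A B lab s τ (i / 2)
        rw [h', hl]
        exact h _
      · rw [h', prodPlay_odd]
        exact h _
    · intro h k
      have := h (2 * k + 1)
      rwa [prodPlay_odd] at this
  unfold meanObj
  by_cases h : jointWord lab s τ ∈ A.language
  · rw [if_pos h, if_pos (hiff.2 (hmem.1 h)), ← longRunAvg_prodPlay]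
    congr 3
    funext i
    rw [prodRewardSafety, if_neg (hmem.1 h i)]
  · rw [if_neg h, if_neg fun h' => h (hmem.2 (hiff.1 h'))]

end Plays

/-! ### Strategies that realize a machine -/

section Realization

variable {I O QA QB S Q : Type*} {A : ParityAutomaton (Letter (I ⊕ O)) QA}
  {B : MeanPayoffAutomaton (Letter (I ⊕ O)) QB} {G : MarkovChain S} {lab : S → Letter I}

/-- The input word of a walk of a labeled Markov chain. -/
def inputWord (lab : S → Letter I) (s : ℕ → S) : ℕ → Letter I := fun n => lab (s (n + 1))

variable (A B lab) in
/-- The play of the product MDP for a walk of the chain when the outputs are those of the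
machine `M`. -/
def machinePlay (M : StateMachine I O Q) (s : ℕ → S) : ℕ → ProdState O QA QB S :=
  prodPlay A B lab s (M.output (inputWord lab s))

/-- The strategy `π` surely chooses the outputs of the machine `M`, on all walks of the chain. -/
def Realizes (π : Strategy (prodMDP A B G lab)) (M : StateMachine I O Q) : Prop :=
  ∀ (s : ℕ → S) (k : ℕ), s 0 = G.init → (∀ i ≤ k, G.edge (s i) (s (i + 1))) →
    π.step (List.ofFn fun i : Fin (2 * k + 1) => machinePlay A B lab M s i)
      (machinePlay A B lab M s (2 * k + 1)) (machinePlay A B lab M s (2 * k + 2)) = 1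

theorem MarkovChain.edge_iff_prob (G : MarkovChain S) (s t : S) :
    G.edge s t ↔ 0 < G.prob s t :=
  G.edge_iff ⟨s, by simp [G.player_empty]⟩ t

theorem Strategy.step_env (π : Strategy (prodMDP A B G lab)) (v : List (ProdState O QA QB S))
    (a : QA) (b : QB) (s : S) (l : Option (QB × Letter O)) :
    π.step v (.env a b s l) = (G.prob s).map (ProdState.sys a b) := by
  have h : (ProdState.env a b s l : ProdState O QA QB S) ∉ (prodMDP A B G lab).player := by
    rintro ⟨a', b', s', h⟩
    cases h
  rw [Strategy.step, dif_neg h]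
  rfl

theorem mem_player_sys (a : QA) (b : QB) (s : S) :
    (ProdState.sys a b s : ProdState O QA QB S) ∈ (prodMDP A B G lab).player := ⟨a, b, s, rfl⟩

theorem Strategy.step_sys (π : Strategy (prodMDP A B G lab)) (v : List (ProdState O QA QB S))
    (a : QA) (b : QB) (s : S) :
    π.step v (.sys a b s) = π.move v ⟨.sys a b s, mem_player_sys a b s⟩ := by
  rw [Strategy.step, dif_pos]

theorem sys_injective (a : QA) (b : QB) :
    Function.Injective (ProdState.sys a b : S → ProdState O QA QB S) := by
  intro s s' h
  cases h
  rfl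

theorem step_env_apply (π : Strategy (prodMDP A B G lab)) (v : List (ProdState O QA QB S))
    (a : QA) (b : QB) (s s' : S) (l : Option (QB × Letter O)) :
    π.step v (.env a b s l) (.sys a b s') = G.prob s s' := by
  rw [Strategy.step_env, PMF.map_apply, tsum_eq_single s']
  · simp
  · intro t ht
    rw [if_neg fun h => ht (sys_injective a b h).symm]

/-! ### Play laws and expectations under a realizing strategy -/

section Law

variable [Finite S] [MeasurableSpace S] [DiscreteMeasurableSpace S]

/-- `Realizes` only concerns walks along edges; this shows that the remaining prefixes are
negligible. -/
theorem edge_of_prefix_ne_zero {s : ℕ → S} {k : ℕ}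
    (h : walkLaw (fun _ t => G.prob t) G.init {ω | ∀ i ≤ k, ω i = s i} ≠ 0) :
    s 0 = G.init ∧ ∀ i < k, G.edge (s i) (s (i + 1)) := by
  induction k with
  | zero =>
    refine ⟨?_, by simp⟩
    by_contra hs
    exact h (walkLaw_prefix_zero_of_ne _ hs)
  | succ k ih =>
    rw [walkLaw_prefix_succ] at h
    obtain ⟨h0, hi⟩ := ih (left_ne_zero_of_mul h)
    refine ⟨h0, fun i hik => ?_⟩
    rcases Nat.lt_succ_iff_lt_or_eq.1 hik with hik | rfl
    · exact hi i hik
    · exact (G.edge_iff_prob _ _).2 (pos_iff_ne_zero.2 (right_ne_zero_of_mul h))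

theorem measurable_inputWord {I S : Type*} {lab : S → Letter I} [MeasurableSpace S]
    [DiscreteMeasurableSpace S] : Measurable (inputWord lab) :=
  measurable_pi_lambda _ fun _ => (Measurable.of_discrete (f := lab)).comp (measurable_pi_apply _)

theorem wordLaw_eq_map : G.wordLaw lab =
    (walkLaw (fun _ t => G.prob t) G.init).map (inputWord lab) := rfl

variable [Finite O] [Finite QA] [Finite QB]

/-- Two moves of the product correspond to one of the chain: the first has the chain's own
probability, the second has probability one. -/
theorem Realizes.playLaw_prefix {π : Strategy (prodMDP A B G lab)} {M : StateMachine I O Q}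
    (hM : Realizes π M) {s : ℕ → S} (hs : s 0 = G.init) {k : ℕ}
    (hk : ∀ i < k, G.edge (s i) (s (i + 1))) :
    π.playLaw (prodMDP A B G lab).init {ω | ∀ i ≤ 2 * k, ω i = machinePlay A B lab M s i} =
      walkLaw (fun _ t => G.prob t) G.init {ω | ∀ i ≤ k, ω i = s i} := by
  unfold Strategy.playLaw
  induction k with
  | zero =>
    rw [walkLaw_prefix_zero _ hs]
    refine walkLaw_prefix_zero _ ?_
    rw [machinePlay, prodPlay_zero, hs]
    rfl
  | succ k ih =>
    rw [show 2 * (k + 1) = 2 * k + 1 + 1 by ring, walkLaw_prefix_succ, walkLaw_prefix_succ,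
      ih fun i hi => hk i (by omega), walkLaw_prefix_succ (fun _ t => G.prob t),
      hM s k hs fun i hi => hk i (by omega), mul_one]
    obtain ⟨l, hl⟩ := prodPlay_even A B lab s (M.output (inputWord lab s)) k
    congr 1
    rw [machinePlay, prodPlay_odd, hl, step_env_apply]

variable [Finite I]

theorem measurable_machinePlay (M : StateMachine I O Q) :
    Measurable (machinePlay A B lab M) := by
  let _ : MeasurableSpace QA := ⊤
  have _ : DiscreteMeasurableSpace QA := ⟨fun _ => trivial⟩
  let _ : MeasurableSpace QB := ⊤
  have _ : DiscreteMeasurableSpace QB := ⟨fun _ => trivial⟩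
  have hw : Measurable fun s : ℕ → S => M.outcome (inputWord lab s) :=
    M.measurable_outcome.comp measurable_inputWord
  have ha (k : ℕ) := (A.toAutomaton.measurable_run k).comp hw
  have hb (k : ℕ) := (B.toAutomaton.measurable_run k).comp hw
  have hs (k : ℕ) : Measurable fun s : ℕ → S => s k := measurable_pi_apply k
  have ho (k : ℕ) := (M.measurable_output k).comp (measurable_inputWord (lab := lab))
  refine measurable_pi_lambda _ fun n => ?_
  obtain ⟨k, rfl | rfl | rfl⟩ : ∃ k, n = 0 ∨ n = 2 * k + 1 ∨ n = 2 * k + 2 :=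
    ⟨(n - 1) / 2, by omega⟩
  · exact (Measurable.of_discrete (f := fun t : S =>
      (.env A.init B.init t none : ProdState O QA QB S))).comp (hs 0)
  · simp only [machinePlay, prodPlay_odd]
    exact (Measurable.of_discrete (f := fun x : QA × QB × S =>
      (.sys x.1 x.2.1 x.2.2 : ProdState O QA QB S))).comp
        ((ha k).prodMk ((hb k).prodMk (hs (k + 1))))
  · simp only [machinePlay, prodPlay_even_succ]
    exact (Measurable.of_discrete (f := fun x : QA × QB × S × Letter O =>
      respond A B lab x.1 x.2.1 x.2.2.1 x.2.2.2)).comp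
        ((ha k).prodMk ((hb k).prodMk ((hs (k + 1)).prodMk (ho k))))

/-- The law of the plays under a strategy that realizes a machine is the image of the law of the
walks of the chain. -/
theorem Realizes.playLaw_eq {π : Strategy (prodMDP A B G lab)} {M : StateMachine I O Q}
    (hM : Realizes π M) :
    π.playLaw (prodMDP A B G lab).init =
      (walkLaw (fun _ t => G.prob t) G.init).map (machinePlay A B lab M) := by
  have hmeas := measurable_machinePlay (A := A) (B := B) (lab := lab) M
  have h1 : IsProbabilityMeasure
      ((walkLaw (fun _ t => G.prob t) G.init).map (machinePlay A B lab M)) :=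
    Measure.isProbabilityMeasure_map hmeas.aemeasurable
  have h2 : IsProbabilityMeasure (π.playLaw (prodMDP A B G lab).init) := by
    unfold Strategy.playLaw
    infer_instance
  refine (measure_eq_of_prefix_le fun k h => ?_).symm
  rw [Measure.map_apply hmeas (measurableSet_prefix _ _)]
  rcases Set.eq_empty_or_nonempty
    (machinePlay A B lab M ⁻¹' {ω | ∀ i ≤ 2 * k, ω i = h i}) with he | ⟨s, hs⟩
  · simp [he]
  replace hs : ∀ i ≤ 2 * k, machinePlay A B lab M s i = h i := hs
  -- The even states of a play record the chain's states, so a prefix of the play determines the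
  -- prefix of the walk. Only this inclusion is needed, since domination on prefixes already gives
  -- equality.
  have hsub : machinePlay A B lab M ⁻¹' {ω | ∀ i ≤ 2 * k, ω i = h i} ⊆
      {ω | ∀ i ≤ k, ω i = s i} := by
    intro s' hs' i hi
    replace hs' : ∀ i ≤ 2 * k, machinePlay A B lab M s' i = h i := hs'
    have he := (hs' (2 * i) (by omega)).trans (hs (2 * i) (by omega)).symm
    obtain ⟨l, hl⟩ := prodPlay_even A B lab s (M.output (inputWord lab s)) i
    obtain ⟨l', hl'⟩ := prodPlay_even A B lab s' (M.output (inputWord lab s')) i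
    rw [machinePlay, machinePlay, hl, hl'] at he
    injection he
  refine (measure_mono hsub).trans ?_
  by_cases h0 : walkLaw (fun _ t => G.prob t) G.init {ω | ∀ i ≤ k, ω i = s i} = 0
  · simp [h0]
  obtain ⟨hs0, hk⟩ := edge_of_prefix_ne_zero h0
  rw [← hM.playLaw_prefix hs0 hk]
  exact measure_mono fun ω hω i hi => (hω i hi).trans (hs i hi)

instance : IsProbabilityMeasure (G.wordLaw lab) :=
  Measure.isProbabilityMeasure_map measurable_inputWord.aemeasurable

theorem satisfies_iff {μ : Measure (ℕ → Letter I)} [IsProbabilityMeasure μ]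
    {L : Set (ℕ → Letter (I ⊕ O))} (hL : MeasurableSet L) (M : StateMachine I O Q) :
    Satisfies μ L M ↔ μ {w | M.outcome w ∉ L} = 0 := by
  have hm : MeasurableSet (M.outcome ⁻¹' L) := M.measurable_outcome hL
  have e : (fun w => L.indicator (fun _ => (1 : ℝ)) (M.outcome w)) =
      (M.outcome ⁻¹' L).indicator (fun _ => (1 : ℝ)) := rfl
  rw [Satisfies, e, integral_indicator_const _ hm, smul_eq_mul, mul_one,
    Measure.real, ENNReal.toReal_eq_one_iff, ← prob_compl_eq_zero_iff hm]
  rfl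

open Classical in
/-- The expectation, under a strategy that realizes `M`, of an objective that is determined by the
outcome of `M`: it is half of the value of `M`, since only every second state of the product MDP
carries a reward. -/
theorem Realizes.expectation_eq {π : Strategy (prodMDP A B G lab)} {M : StateMachine I O Q}
    (hM : Realizes π M) {f : (ℕ → ProdState O QA QB S) → EReal} (hf : Measurable f)
    (hval : ∀ s τ, f (prodPlay A B lab s τ) = if jointWord lab s τ ∈ A.language then
        ((B.language (jointWord lab s τ) / 2 : ℝ) : EReal) else ⊥) :
    π.expectation (prodMDP A B G lab).init f =
      if Satisfies (G.wordLaw lab) A.language M then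
        (((∫ w, B.language (M.outcome w) ∂G.wordLaw lab) / 2 : ℝ) : EReal) else ⊥ := by
  have hmeas := measurable_machinePlay (A := A) (B := B) (lab := lab) M
  have hin := measurable_inputWord (lab := lab)
  have hA := A.measurableSet_language
  have hval' (s : ℕ → S) : f (machinePlay A B lab M s) =
      if M.outcome (inputWord lab s) ∈ A.language then
        ((B.language (M.outcome (inputWord lab s)) / 2 : ℝ) : EReal) else ⊥ := hval _ _
  set P := walkLaw (fun _ t => G.prob t) G.init with hP
  have hB : Measurable fun w => B.language (M.outcome w) :=
    B.measurable_language.comp M.measurable_outcome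
  have hnot : MeasurableSet {w | M.outcome w ∉ A.language} := (M.measurable_outcome hA).compl
  have hbot : P.map (machinePlay A B lab M) {ω | f ω = ⊥} =
      G.wordLaw lab {w | M.outcome w ∉ A.language} := by
    have hfm : MeasurableSet {ω | f ω = ⊥} := hf (measurableSet_singleton ⊥)
    rw [Measure.map_apply hmeas hfm, wordLaw_eq_map,
      Measure.map_apply hin hnot]
    congr 1
    ext s
    change f (machinePlay A B lab M s) = ⊥ ↔ M.outcome (inputWord lab s) ∉ A.language
    rw [hval']
    split_ifs with h <;> simp [h]
  rw [Strategy.expectation, hM.playLaw_eq, expect, hbot]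
  by_cases h : G.wordLaw lab {w | M.outcome w ∉ A.language} = 0
  · rw [if_pos h, if_pos ((satisfies_iff hA M).2 h), integral_map hmeas.aemeasurable
      hf.ereal_toReal.aestronglyMeasurable, wordLaw_eq_map, integral_map hin.aemeasurable
      hB.aestronglyMeasurable,
      ← integral_div]
    have hae : ∀ᵐ s ∂P, M.outcome (inputWord lab s) ∈ A.language := by
      rw [wordLaw_eq_map, Measure.map_apply hin hnot] at h
      exact h
    congr 1
    -- `toReal` sends `⊥` to 0, but here `⊥` occurs only on a null set.
    refine integral_congr_ae (hae.mono fun s hs => ?_)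
    simp only [hval', if_pos hs, EReal.toReal_coe]
  · rw [if_neg h, if_neg fun h' => h ((satisfies_iff hA M).1 h')]

end Law

end Realization

/-! ### Translating between pure strategies and machines, and transfer of optimality -/

section Construction

variable {I O QA QB S Q : Type*} {A : ParityAutomaton (Letter (I ⊕ O)) QA}
  {B : MeanPayoffAutomaton (Letter (I ⊕ O)) QB} {G : MarkovChain S} {lab : S → Letter I}

theorem pmf_eq_of_apply_eq_one {α : Type*} {p : PMF α} {a b : α} (ha : p a = 1) (hb : 0 < p b) :
    b = a := by
  have h := (PMF.apply_eq_one_iff p a).1 ha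
  have : b ∈ p.support := (PMF.mem_support_iff p b).2 hb.ne'
  rwa [h] at this

theorem prodMDP_deterministic (hdet : G.Deterministic lab) :
    (prodMDP A B G lab).Deterministic (prodLabel lab) := by
  rintro (⟨a, b, s, l⟩ | ⟨a, b, s⟩) t t' ht ht' h
  · obtain ⟨u, hu, rfl⟩ := ht
    obtain ⟨u', hu', rfl⟩ := ht'
    rw [hdet s u u' hu hu' (Sum.inl_injective h)]
  · obtain ⟨τ, rfl⟩ := ht
    obtain ⟨τ', rfl⟩ := ht'
    obtain rfl : τ = τ' := Sum.inr_injective h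
    rfl

theorem prodMDP_completeAlternating (hcomp : G.Complete lab) :
    (prodMDP A B G lab).CompleteAlternating (prodLabel lab) := by
  constructor
  · rintro (⟨a, b, s, l⟩ | ⟨a, b, s⟩) hs
    · refine ⟨fun σ => ?_, ?_⟩
      · obtain ⟨t, ht, rfl⟩ := hcomp s σ
        exact ⟨_, ⟨t, ht, rfl⟩, rfl⟩
      · rintro _ ⟨t, _, rfl⟩
        exact ⟨_, rfl⟩
    · exact absurd (mem_player_sys a b s) hs
  · rintro _ ⟨a, b, s, rfl⟩
    refine ⟨fun τ => ⟨_, ⟨τ, rfl⟩, rfl⟩, ?_⟩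
    rintro _ ⟨τ, rfl⟩
    exact ⟨_, rfl⟩

/-- The chain component of a state of the product MDP. -/
def ProdState.chain : ProdState O QA QB S → S
  | .env _ _ s _ => s
  | .sys _ _ s => s

/-- The intermediate state that is reached from a probabilistic state when the chain moves to
`t`. -/
def ProdState.toSys (x : ProdState O QA QB S) (t : S) : ProdState O QA QB S :=
  match x with
  | .env a b _ _ => .sys a b t
  | .sys a b _ => .sys a b t

/-- The output letter stored in a state of the product MDP. -/
def ProdState.lastOutput : ProdState O QA QB S → Letter O
  | .env _ _ _ (some (_, τ)) => τ
  | _ => ∅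

/-- Completeness provides a walk of the chain with the prescribed inputs, and the machine's play
along it is consistent. Conversely, the odd positions of a consistent play yield a walk, and by
induction the play is the machine's play along it: the chain moves along edges, and a move of
probability one is forced. -/
theorem Realizes.corresponds {π : Strategy (prodMDP A B G lab)} {M : StateMachine I O Q}
    (hM : Realizes π M) (hcomp : G.Complete lab) : Corresponds (prodLabel lab) π M := by
  intro w
  refine ⟨?_, fun ω ⟨h0, hω⟩ hw => ?_⟩
  · choose next hnext hlab using hcomp
    let s : ℕ → S := fun n => Nat.rec G.init (fun k t => next t (w k)) n
    have hs (k : ℕ) : G.edge (s k) (s (k + 1)) := hnext _ _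
    have hw : inputWord lab s = w := funext fun k => hlab _ _
    refine ⟨machinePlay A B lab M s, ⟨rfl, fun n => ?_⟩, fun k => ?_⟩
    · obtain ⟨k, rfl | rfl⟩ : ∃ k, n = 2 * k ∨ n = 2 * k + 1 := ⟨n / 2, by omega⟩
      · obtain ⟨l, hl⟩ := prodPlay_even A B lab s (M.output (inputWord lab s)) k
        rw [machinePlay, prodPlay_odd, hl, step_env_apply]
        exact (G.edge_iff_prob _ _).1 (hs k)
      · rw [hM s k rfl fun i _ => hs i]
        exact one_pos
    · rw [machinePlay, prodPlay_odd]
      exact congrArg Sum.inl (congrFun hw k)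
  · let s : ℕ → S := fun n => match n with
      | 0 => G.init
      | k + 1 => (ω (2 * k + 1)).chain
    have hodd (k : ℕ) (heq : ∀ i ≤ 2 * k, ω i = machinePlay A B lab M s i) :
        ω (2 * k + 1) = machinePlay A B lab M s (2 * k + 1) ∧ G.edge (s k) (s (k + 1)) := by
      have hstep := hω (2 * k)
      rw [heq _ le_rfl] at hstep
      obtain ⟨l, hl⟩ := prodPlay_even A B lab s (M.output (inputWord lab s)) k
      rw [machinePlay, hl, Strategy.step_env] at hstep
      obtain ⟨t, ht, he⟩ := (PMF.mem_support_map_iff _ _ _).1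
        ((PMF.mem_support_iff _ _).2 hstep.ne')
      have hst : s (k + 1) = t := by
        change (ω (2 * k + 1)).chain = t
        rw [← he]; rfl
      rw [machinePlay, prodPlay_odd, hst]
      exact ⟨he.symm, (G.edge_iff_prob _ _).2 (pos_iff_ne_zero.2 ((PMF.mem_support_iff _ _).1 ht))⟩
    have hmain (k : ℕ) : (∀ i ≤ 2 * k, ω i = machinePlay A B lab M s i) ∧
        ∀ i < k, G.edge (s i) (s (i + 1)) := by
      induction k with
      | zero =>
        refine ⟨fun i hi => ?_, by simp⟩
        obtain rfl : i = 0 := by omega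
        exact h0
      | succ k ih =>
        obtain ⟨heq, hedge⟩ := ih
        obtain ⟨h1, h2⟩ := hodd k heq
        have hedge' : ∀ i ≤ k, G.edge (s i) (s (i + 1)) := fun i hi =>
          (Nat.lt_or_eq_of_le hi).elim (hedge i) fun h => h ▸ h2
        have heq' : ∀ i ≤ 2 * k + 1, ω i = machinePlay A B lab M s i := fun i hi =>
          (Nat.lt_or_eq_of_le hi).elim (fun h => heq i (by omega)) fun h => h ▸ h1
        refine ⟨fun i hi => ?_, fun i hi => hedge' i (by omega)⟩
        rcases Nat.lt_or_eq_of_le hi with hi | rfl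
        · exact heq' i (by omega)
        · have hstep := hω (2 * k + 1)
          have hlist : (List.ofFn fun i : Fin (2 * k + 1) => ω i) =
              List.ofFn fun i : Fin (2 * k + 1) => machinePlay A B lab M s i :=
            congrArg List.ofFn (funext fun i => heq' i i.2.le)
          rw [hlist, h1] at hstep
          exact pmf_eq_of_apply_eq_one (hM s k rfl hedge') hstep
    have hws : inputWord lab s = w := by
      funext k
      have := hw k
      rw [(hodd k (hmain k).1).1, machinePlay, prodPlay_odd] at this
      exact Sum.inl_injective this
    intro k
    rw [(hmain (k + 1)).1 (2 * k + 2) (by omega), machinePlay, prodPlay_even_succ, hws]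
    rfl

/-- The pure strategy that plays the outputs of a machine. -/
noncomputable def StateMachine.toStrategy (M : StateMachine I O Q) (A : ParityAutomaton (Letter (I ⊕ O)) QA)
    (B : MeanPayoffAutomaton (Letter (I ⊕ O)) QB) (G : MarkovChain S) (lab : S → Letter I) :
    Strategy (prodMDP A B G lab) where
  move v y := match y with
    -- The past inputs are the labels of the intermediate states in the history; the current input
    -- is the label of the present state.
    | ⟨.sys a b s, _⟩ => PMF.pure (respond A B lab a b s (M.out (v.foldl (fun q x => match x with
        | .sys _ _ t => M.next q (lab t)
        | .env _ _ _ _ => q) M.init) (lab s)))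
    | ⟨.env a b s l, h⟩ => absurd h (by rintro ⟨_, _, _, h⟩; cases h)
  legal := by
    rintro v ⟨x | ⟨a, b, s⟩, h⟩ t ht
    · obtain ⟨_, _, _, h⟩ := h
      cases h
    · have := (PMF.mem_support_iff _ _).2 ht.ne'
      rw [PMF.support_pure] at this
      exact ⟨_, this⟩

theorem foldl_ofFn_succ {α β : Type*} (f : β → α → β) (b : β) (x : ℕ → α) (n : ℕ) :
    (List.ofFn fun i : Fin (n + 1) => x i).foldl f b =
      f ((List.ofFn fun i : Fin n => x i).foldl f b) (x n) := by
  rw [List.ofFn_succ']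
  simp

theorem StateMachine.realizes_toStrategy (M : StateMachine I O Q) :
    Realizes (M.toStrategy A B G lab) M := by
  intro s k _ _
  have hfold (k : ℕ) : (List.ofFn fun i : Fin (2 * k + 1) => machinePlay A B lab M s i).foldl
      (fun q x => match x with
        | .sys _ _ t => M.next q (lab t)
        | .env _ _ _ _ => q) M.init = M.run (inputWord lab s) k := by
    induction k with
    | zero => rfl
    | succ k ih =>
      -- Of the two new history states, only the intermediate one feeds a letter to the machine.
      rw [show 2 * (k + 1) + 1 = 2 * k + 1 + 1 + 1 by ring, foldl_ofFn_succ, foldl_ofFn_succ, ih]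
      simp only [machinePlay, prodPlay_odd, prodPlay_even_succ, respond]
      rfl
  rw [machinePlay, prodPlay_odd, prodPlay_even_succ, Strategy.step_sys]
  change PMF.pure (respond A B lab _ _ _ (M.out (List.foldl _ _ _) _)) _ = 1
  have := hfold k
  unfold machinePlay at this
  rw [this]
  exact (PMF.apply_eq_one_iff _ _).2 (PMF.support_pure _)

/-- A strategy that surely plays a move computed by a memory with contents `K` is realized by a
machine whose states are pairs of a memory content and (the code of) a probabilistic state. -/
theorem exists_realizes_of_memory {K X : Type} (π : Strategy (prodMDP A B G lab))
    (e : ProdState O QA QB S ≃ X) (k₀ : K) (upd : K → ProdState O QA QB S → K)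
    (mv : K → ProdState O QA QB S → ProdState O QA QB S)
    (hπ : ∀ (v : List (ProdState O QA QB S)) (y : (prodMDP A B G lab).player),
      π.move v y (mv (v.foldl upd k₀) y) = 1)
    (hdet : G.Deterministic lab) (hcomp : G.Complete lab) :
    ∃ M : StateMachine I O (K × X), Realizes π M := by
  choose succ hsucc hlab using hcomp
  let sysOf (x : X) (σ : Letter I) : ProdState O QA QB S :=
    (e.symm x).toSys (succ (e.symm x).chain σ)
  let resp (q : K × X) (σ : Letter I) : ProdState O QA QB S :=
    mv (upd q.1 (e.symm q.2)) (sysOf q.2 σ)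
  -- After `k` letters the machine holds the memory for positions before `2 * k` and the code of the
  -- state at `2 * k`. One letter advances it by two positions of the play, so `upd` is applied
  -- twice.
  let M : StateMachine I O (K × X) :=
    { init := (k₀, e (.env A.init B.init G.init none))
      next := fun q σ => (upd (upd q.1 (e.symm q.2)) (sysOf q.2 σ), e (resp q σ))
      out := fun q σ => (resp q σ).lastOutput }
  refine ⟨M, fun s k hs0 => ?_⟩
  have hstep (k : ℕ) (hedge : G.edge (s k) (s (k + 1)))
      (hrun : M.run (inputWord lab s) k =
        ((List.ofFn fun i : Fin (2 * k) => machinePlay A B lab M s i).foldl upd k₀,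
          e (machinePlay A B lab M s (2 * k)))) :
      π.step (List.ofFn fun i : Fin (2 * k + 1) => machinePlay A B lab M s i)
        (machinePlay A B lab M s (2 * k + 1)) (machinePlay A B lab M s (2 * k + 2)) = 1 ∧
      M.run (inputWord lab s) (k + 1) =
        ((List.ofFn fun i : Fin (2 * (k + 1)) => machinePlay A B lab M s i).foldl upd k₀,
          e (machinePlay A B lab M s (2 * (k + 1)))) := by
    have hsys : sysOf (e (machinePlay A B lab M s (2 * k))) (inputWord lab s k) =
        machinePlay A B lab M s (2 * k + 1) := by
      obtain ⟨l, hl⟩ := prodPlay_even A B lab s (M.output (inputWord lab s)) k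
      simp only [sysOf, Equiv.symm_apply_apply]
      rw [machinePlay, hl, prodPlay_odd]
      change ProdState.sys _ _ (succ (s k) (inputWord lab s k)) = _
      rw [hdet _ _ _ (hsucc (s k) (inputWord lab s k)) hedge (hlab _ _)]
    have hresp : resp (M.run (inputWord lab s) k) (inputWord lab s k) =
        mv ((List.ofFn fun i : Fin (2 * k + 1) => machinePlay A B lab M s i).foldl upd k₀)
          (machinePlay A B lab M s (2 * k + 1)) := by
      simp only [resp, hrun, hsys, Equiv.symm_apply_apply, foldl_ofFn_succ]
    have hmove : π.step (List.ofFn fun i : Fin (2 * k + 1) => machinePlay A B lab M s i)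
        (machinePlay A B lab M s (2 * k + 1))
        (resp (M.run (inputWord lab s) k) (inputWord lab s k)) = 1 := by
      have hy : machinePlay A B lab M s (2 * k + 1) = .sys _ _ _ := prodPlay_odd ..
      rw [hresp, hy, Strategy.step_sys]
      exact hπ _ ⟨_, mem_player_sys _ _ _⟩
    have hnext : machinePlay A B lab M s (2 * k + 2) =
        resp (M.run (inputWord lab s) k) (inputWord lab s k) := by
      have hy : machinePlay A B lab M s (2 * k + 1) = .sys _ _ _ := prodPlay_odd ..
      rw [hy, Strategy.step_sys] at hmove
      -- A legal move is a response to some output letter, and that letter is stored in the target.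
      -- Hence the machine's output recovers the full move.
      obtain ⟨τ, hτ⟩ := π.legal _ _ _ (hmove ▸ one_pos)
      have hout : M.output (inputWord lab s) k = τ := by
        change (resp (M.run (inputWord lab s) k) (inputWord lab s k)).lastOutput = τ
        rw [hτ]
        rfl
      rw [hτ, machinePlay, prodPlay_even_succ, hout]
    refine ⟨hnext ▸ hmove, ?_⟩
    change M.next (M.run (inputWord lab s) k) (inputWord lab s k) = _
    refine Prod.ext ?_ (congrArg e hnext.symm)
    change upd (upd (M.run (inputWord lab s) k).1 (e.symm (M.run (inputWord lab s) k).2))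
      (sysOf (M.run (inputWord lab s) k).2 (inputWord lab s k)) = _
    rw [show 2 * (k + 1) = 2 * k + 1 + 1 by ring, foldl_ofFn_succ, foldl_ofFn_succ, hrun, hsys,
      Equiv.symm_apply_apply]
  intro hedge
  have hrun (j : ℕ) (hj : j ≤ k) : M.run (inputWord lab s) j =
      ((List.ofFn fun i : Fin (2 * j) => machinePlay A B lab M s i).foldl upd k₀,
        e (machinePlay A B lab M s (2 * j))) := by
    induction j with
    | zero =>
      refine Prod.ext rfl (congrArg e ?_)
      rw [machinePlay, prodPlay_zero, hs0]
    | succ j ih => exact (hstep j (hedge j (by omega)) (ih (by omega))).2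
  exact (hstep k (hedge k le_rfl) (hrun k le_rfl)).1

/-- A finite-state strategy supplies its own memory; any other pure strategy uses the entire history
as memory. -/
theorem exists_realizes_of_isPure [Finite O] [Finite QA] [Finite QB] [Finite S]
    {π : Strategy (prodMDP A B G lab)} (hπ : π.IsPure) (hdet : G.Deterministic lab)
    (hcomp : G.Complete lab) :
    ∃ (Q : Type) (M : StateMachine I O Q), (π.IsPureFiniteState → Finite Q) ∧ Realizes π M := by
  -- Coding product states by `Fin n` keeps the machine's state set in `Type`, whatever the
  -- universes of the data.
  obtain ⟨n, ⟨e⟩⟩ := Finite.exists_equiv_fin (ProdState O QA QB S)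
  by_cases hfin : π.IsPureFiniteState
  · obtain ⟨K, hK, k₀, upd, mv, h⟩ := hfin
    obtain ⟨M, hM⟩ := exists_realizes_of_memory π e k₀ upd mv h hdet hcomp
    exact ⟨_, M, fun _ => inferInstance, hM⟩
  · choose mv hmv using hπ
    classical
    obtain ⟨M, hM⟩ := exists_realizes_of_memory π e ([] : List (Fin n)) (fun v x => v ++ [e x])
      -- The value outside player states is arbitrary, since no move is chosen there.
      (fun v y => if hy : y ∈ (prodMDP A B G lab).player then mv (v.map e.symm) ⟨y, hy⟩ else y)
      (fun v y => by
        have hv (u : List (Fin n)) : v.foldl (fun v x => v ++ [e x]) u = u ++ v.map e := by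
          induction v generalizing u with
          | nil => simp
          | cons x v ih => simp [ih]
        rw [dif_pos y.2, hv]
        simpa using hmv v y) hdet hcomp
    exact ⟨_, M, fun h => absurd h hfin, hM⟩

/-- Only measurability and the values on plays of the form `prodPlay` matter, so the argument serves
the parity and the safety objective at once. -/
theorem exists_optimal_machine [Finite I] [Finite O] [Finite QA] [Finite QB] [Finite S]
    [MeasurableSpace S] [DiscreteMeasurableSpace S] (hdet : G.Deterministic lab)
    (hcomp : G.Complete lab) {f : (ℕ → ProdState O QA QB S) → EReal} (hf : Measurable f)
    (hval : ∀ s τ, f (prodPlay A B lab s τ) = open Classical in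
      if jointWord lab s τ ∈ A.language then
        ((B.language (jointWord lab s τ) / 2 : ℝ) : EReal) else ⊥)
    {π : Strategy (prodMDP A B G lab)} (hπ : π.IsPure)
    (hopt : π.IsOptimal (prodMDP A B G lab).init f)
    (hbot : π.expectation (prodMDP A B G lab).init f ≠ ⊥) :
    ∃ (Q : Type) (M : StateMachine I O Q),
      (π.IsPureFiniteState → Finite Q) ∧
      Corresponds (prodLabel lab) π M ∧
      Satisfies (G.wordLaw lab) A.language M ∧
      Optimizes.{v} (G.wordLaw lab) A.language B.language M := by
  classical
  obtain ⟨Q, M, hfin, hM⟩ := exists_realizes_of_isPure hπ hdet hcomp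
  have hE := hM.expectation_eq hf hval
  have hsat : Satisfies (G.wordLaw lab) A.language M := by
    by_contra h
    rw [if_neg h] at hE
    exact hbot hE
  rw [if_pos hsat] at hE
  refine ⟨Q, M, hfin, hM.corresponds hcomp, hsat, fun Q' M' => ?_⟩
  rw [machineValue, machineValue, if_pos hsat]
  split_ifs with hsat'
  · have hE' := M'.realizes_toStrategy.expectation_eq (A := A) (B := B) (G := G) hf hval
    rw [if_pos hsat'] at hE'
    have hle : (M'.toStrategy A B G lab).expectation (prodMDP A B G lab).init f ≤
        π.expectation (prodMDP A B G lab).init f := by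
      rw [← hopt]
      exact le_iSup (fun π' : Strategy (prodMDP A B G lab) =>
        π'.expectation (prodMDP A B G lab).init f) _
    rw [hE, hE', EReal.coe_le_coe_iff] at hle
    rw [EReal.coe_le_coe_iff]
    -- The factor one half is common to both expectations and cancels.
    linarith
  · exact bot_le

end Construction

end QSynth

theorem mainTheorem8 {I O QA QB S : Type*}
    [Finite I] [Finite O] [Finite QA] [Finite QB] [Finite S]
    [MeasurableSpace S] [DiscreteMeasurableSpace S]
    (A : ParityAutomaton (Letter (I ⊕ O)) QA)
    (B : MeanPayoffAutomaton (Letter (I ⊕ O)) QB)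
    (G : MarkovChain S) (lab : S → Letter I)
    (hdet : G.Deterministic lab) (hcomp : G.Complete lab) :
    (prodMDP A B G lab).Deterministic (prodLabel lab) ∧
    (prodMDP A B G lab).CompleteAlternating (prodLabel lab) ∧
    (A.IsSafety →
      ∀ π : Strategy (prodMDP A B G lab), π.IsPure →
        π.IsOptimal (prodMDP A B G lab).init (meanObj (prodRewardSafety A B lab)) →
        π.expectation (prodMDP A B G lab).init (meanObj (prodRewardSafety A B lab)) ≠ ⊥ →
        ∃ (Q : Type) (M : StateMachine I O Q),
          (π.IsPureFiniteState → Finite Q) ∧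
          Corresponds (prodLabel lab) π M ∧
          Satisfies (G.wordLaw lab) A.language M ∧
          Optimizes.{v} (G.wordLaw lab) A.language B.language M) ∧
    (∀ π : Strategy (prodMDP A B G lab), π.IsPure →
        π.IsOptimal (prodMDP A B G lab).init
          (meanParityObj (prodPriority A) (prodReward B lab)) →
        π.expectation (prodMDP A B G lab).init
          (meanParityObj (prodPriority A) (prodReward B lab)) ≠ ⊥ →
        ∃ (Q : Type) (M : StateMachine I O Q),
          (π.IsPureFiniteState → Finite Q) ∧
          Corresponds (prodLabel lab) π M ∧
          Satisfies (G.wordLaw lab) A.language M ∧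
          Optimizes.{v} (G.wordLaw lab) A.language B.language M) := by
  have hm := measurable_meanParityObj (prodPriority (S := S) (QB := QB) A) (prodReward B lab)
  refine ⟨prodMDP_deterministic hdet, prodMDP_completeAlternating hcomp,
    fun hA π hπ hopt hbot => ?_, fun π hπ hopt hbot => ?_⟩
  · exact exists_optimal_machine hdet hcomp (measurable_meanObj _)
      (fun s τ => meanObj_prodRewardSafety_prodPlay A B lab s τ hA) hπ hopt hbot
  · exact exists_optimal_machine hdet hcomp hm
      (fun s τ => meanParityObj_prodPlay A B lab s τ) hπ hopt hbot
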